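/- Let $n\ge 1$ and let $M$ be a smooth $4n$-dimensional manifold with smooth almost complex structures $J_1,J_2,J_3$ such that $J_\alpha=J_\beta J_\gamma=-J_\gamma J_\beta$ and $J_\alpha^2=-I$ for all cyclic permutations $(\alpha,\beta,\gamma)$ of $(1,2,3)$, and with a pseudo-Riemannian metric $g$ such that $g(x,y)=\varepsilon_\alpha g(J_\alpha x,J_\alpha y)$, where $\varepsilon_1=1$, $\varepsilon_2=\varepsilon_3=-1$. Let $\nabla$ be the Levi-Civita connection of $g$, and put $g_\alpha(x,y)=g(J_\alpha x,y)$, $F_\alpha(x,y,z)=g((\nabla_xJ_\alpha)y,z)$ and $\theta_\alpha(z)=g^{ij}F_\alpha(e_i,e_j,z)$. Assume that $M$ is a $\mathcal W$-manifold, that is, $$F_1(x,y,z)=\tfrac{1}{2(2n-1)}\{g(x,y)\theta_1(z)-g(x,z)\theta_1(y)-g(x,J_1y)\theta_1(J_1z)+g(x,J_1z)\theta_1(J_1y)\},$$ $$F_\alpha(x,y,z)=\tfrac1{4n}\{g(x,y)\theta_\alpha(z)+g(x,z)\theta_\alpha(y)+g(x,J_\alpha y)\theta_\alpha(J_\alpha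 z)+g(x,J_\alpha z)\theta_\alpha(J_\alpha y)\}\quad(\alpha=2,3).$$ Let $\theta=\frac{4n}{1-\varepsilon_\alpha(4n-1)}\,\theta_\alpha\circ J_\alpha$ (which on a $\mathcal W$-manifold does not depend on $\alpha\in\{1,2,3\}$), let $\Omega$ be the vector field with $\theta=g(\cdot,\Omega)$, and let $D$ be the connection $D_yz=\nabla_yz+\frac14\sum_{\alpha=1}^3(\nabla_yJ_\alpha)J_\alpha z$. Let $R$ and $K$ be the curvature tensors of $\nabla$ and $D$, where a connection $\nabla'$ has the curvature tensor $(x,y,z,w)\mapsto g(\nabla'_x\nabla'_yz-\nabla'_y\nabla'_xz-\nabla'_{[x,y]}z,\,w)$. For a $(0,4)$-tensor $L$ put $(L\circ J_\alpha)(x,y,z,w)=L(x,y,J_\alpha z,J_\alpha w)$, and let $(g\odot h)(x,y,z,w)=g(x,z)h(y,w)-g(y,z)h(x,w)+g(y,w)h(x,z)-g(x,w)h(y,z)$. Then $$K=\tfrac14\{\hat S+\hat S\circ J_1-\hat S\circ J_2-\hat S\circ J_3\},\qquad \hat S=R+\tfrac1{64n^2}\,g\odot B+\tfrac1{128n^2}\,U,$$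 where $$B=3\,\theta\otimes\theta+\sum_{\alpha=1}^3(\theta\circ J_\alpha)\otimes(\theta\circ J_\alpha)-\tfrac32\theta(\Omega)g-\tfrac12\theta(J_2\Omega)g_2-\tfrac12\theta(J_3\Omega)g_3,$$ $$U(x,y,z,w)=g_1(x,y)E(z,w),\qquad E=\theta\otimes(\theta\circ J_1)-(\theta\circ J_1)\otimes\theta-(\theta\circ J_2)\otimes(\theta\circ J_3)+(\theta\circ J_3)\otimes(\theta\circ J_2).$$ -/

import Mathlib

open Bundle Manifold
open scoped Manifold ContDiff

noncomputable section

/-- The real vector space modelling a `4n`-dimensional manifold. -/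
abbrev HGModel (n : ℕ) : Type := EuclideanSpace ℝ (Fin (4 * n))

/-- The tangent space of a `4n`-dimensional manifold at a point. -/
abbrev HGTangent (n : ℕ) {M : Type*} [TopologicalSpace M] [ChartedSpace (HGModel n) M]
    (p : M) : Type :=
  TangentSpace (𝓡 (4 * n)) p

/-- The signs `ε₁ = 1`, `ε₂ = ε₃ = -1`. The indices `1, 2, 3` are `0, 1, 2 : Fin 3`, so that
`(α, α + 1, α + 2)` runs through the cyclic permutations. -/
def hgSign : Fin 3 → ℝ := ![1, -1, -1]

/-! ### Contraction with a nondegenerate symmetric form -/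

/-- The contraction `gⁱʲ b(eᵢ, eⱼ)` of a bilinear form `b` by means of a nondegenerate form `g`:
the trace of the endomorphism `T` with `g (T x) y = b x y`. -/
def metricContraction {V : Type*} [AddCommGroup V] [Module ℝ V] [FiniteDimensional ℝ V]
    (g : LinearMap.BilinForm ℝ V) (hg : g.Nondegenerate) (b : LinearMap.BilinForm ℝ V) : ℝ :=
  LinearMap.trace ℝ V ((g.toDual hg).symm.toLinearMap ∘ₗ b)

/-- The contraction in terms of an arbitrary basis: `gⁱʲ b(eᵢ, eⱼ)`. -/
theorem metricContraction_eq_sum {V ι : Type*} [AddCommGroup V] [Module ℝ V]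
    [FiniteDimensional ℝ V] [Fintype ι] [DecidableEq ι]
    (g : LinearMap.BilinForm ℝ V) (hg : g.Nondegenerate) (hs : ∀ x y, g x y = g y x)
    (b : LinearMap.BilinForm ℝ V) (e : Module.Basis ι ℝ V) :
    metricContraction g hg b =
      ∑ i, ∑ j, (Matrix.of fun k l => g (e k) (e l))⁻¹ i j * b (e i) (e j) := by
  set G : Matrix ι ι ℝ := Matrix.of fun k l => g (e k) (e l) with hG
  set T : V →ₗ[ℝ] V := (g.toDual hg).symm.toLinearMap ∘ₗ b with hT
  have hTb : ∀ x y, g (T x) y = b x y := fun x y => by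
    rw [← LinearMap.BilinForm.toDual_def hg]; simp [hT]
  set A : Matrix ι ι ℝ := LinearMap.toMatrix e e T with hA
  have hAG : A.transpose * G = Matrix.of fun i j => b (e i) (e j) := by
    ext i j
    have h1 : T (e i) = ∑ k, A k i • e k := by
      rw [hA]; simp only [LinearMap.toMatrix_apply]; exact (e.sum_repr (T (e i))).symm
    rw [Matrix.mul_apply, Matrix.of_apply, ← hTb, h1]
    simp [hG]
  have hdet : IsUnit G.det := by
    have : G = LinearMap.BilinForm.toMatrix e g := by ext; simp [hG]
    rw [this, isUnit_iff_ne_zero]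
    exact (LinearMap.BilinForm.nondegenerate_iff_det_ne_zero e).1 hg
  have hAt : A.transpose = (Matrix.of fun i j => b (e i) (e j)) * G⁻¹ := by
    rw [← hAG, Matrix.mul_assoc, Matrix.mul_nonsing_inv G hdet, Matrix.mul_one]
  have htr : metricContraction g hg b = A.transpose.trace := by
    rw [Matrix.trace_transpose, hA, ← LinearMap.trace_eq_matrix_trace]; rfl
  have hsymm : G⁻¹.transpose = G⁻¹ := by
    rw [Matrix.transpose_nonsing_inv]
    congr 1
    ext i j
    simp [hG, hs (e i) (e j)]
  rw [htr, hAt, Matrix.trace]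
  simp only [Matrix.diag_apply, Matrix.mul_apply, Matrix.of_apply]
  refine Finset.sum_congr rfl fun i _ => Finset.sum_congr rfl fun j _ => ?_
  rw [mul_comm]
  congr 1
  rw [← Matrix.transpose_apply G⁻¹, hsymm]

theorem metricContraction_add {V : Type*} [AddCommGroup V] [Module ℝ V] [FiniteDimensional ℝ V]
    (g : LinearMap.BilinForm ℝ V) (hg : g.Nondegenerate) (b c : LinearMap.BilinForm ℝ V) :
    metricContraction g hg (b + c) = metricContraction g hg b + metricContraction g hg c := by
  simp [metricContraction, LinearMap.comp_add]

theorem metricContraction_smul {V : Type*} [AddCommGroup V] [Module ℝ V] [FiniteDimensional ℝ V]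
    (g : LinearMap.BilinForm ℝ V) (hg : g.Nondegenerate) (r : ℝ) (b : LinearMap.BilinForm ℝ V) :
    metricContraction g hg (r • b) = r * metricContraction g hg b := by
  simp [metricContraction, LinearMap.comp_smul]

/-! ### Affine connections -/

section Connections

variable {n : ℕ} {M : Type*} [TopologicalSpace M] [ChartedSpace (HGModel n) M]
  [IsManifold (𝓡 (4 * n)) ∞ M]

variable (n M) in
/-- A linear connection on a `4n`-dimensional manifold. For a connection `D`, the vector
`D Z p v` is the covariant derivative of the vector field `Z` at `p` in the direction `v`. -/
abbrev HGConnection : Type _ :=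
  CovariantDerivative (𝓡 (4 * n)) (HGModel n) (TangentSpace (𝓡 (4 * n)) : M → Type _)

/-- Smoothness of a field of endomorphisms of the tangent spaces. -/
def SmoothEndo (A : Π p : M, HGTangent n p →L[ℝ] HGTangent n p) : Prop :=
  ContMDiff (𝓡 (4 * n)) ((𝓡 (4 * n)).prod 𝓘(ℝ, HGModel n →L[ℝ] HGModel n)) ∞
    (fun p ↦ (TotalSpace.mk' (HGModel n →L[ℝ] HGModel n) p (A p) :
      TotalSpace (HGModel n →L[ℝ] HGModel n)
        (fun p : M ↦ TangentSpace (𝓡 (4 * n)) p →L[ℝ] TangentSpace (𝓡 (4 * n)) p)))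

/-- Smoothness of a field of bilinear forms on the tangent spaces. -/
def SmoothBilin (g : Π p : M, HGTangent n p →L[ℝ] HGTangent n p →L[ℝ] ℝ) : Prop :=
  ContMDiff (𝓡 (4 * n)) ((𝓡 (4 * n)).prod 𝓘(ℝ, HGModel n →L[ℝ] HGModel n →L[ℝ] ℝ)) ∞
    (fun p ↦ (TotalSpace.mk' (HGModel n →L[ℝ] HGModel n →L[ℝ] ℝ) p (g p) :
      TotalSpace (HGModel n →L[ℝ] HGModel n →L[ℝ] ℝ)
        (fun p : M ↦ TangentSpace (𝓡 (4 * n)) p →L[ℝ] TangentSpace (𝓡 (4 * n)) p →L[ℝ] ℝ)))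

/-- Smoothness of a vector field. -/
def SmoothField (X : Π p : M, HGTangent n p) : Prop :=
  ContMDiff (𝓡 (4 * n)) ((𝓡 (4 * n)).prod 𝓘(ℝ, HGModel n)) ∞
    (fun p ↦ (TotalSpace.mk' (HGModel n) p (X p) :
      TotalSpace (HGModel n) (TangentSpace (𝓡 (4 * n)) : M → Type _)))

/-- Differentiability of a vector field at a point. -/
def DiffFieldAt (X : Π p : M, HGTangent n p) (p : M) : Prop :=
  MDifferentiableAt (𝓡 (4 * n)) ((𝓡 (4 * n)).prod 𝓘(ℝ, HGModel n))
    (fun q ↦ (TotalSpace.mk' (HGModel n) q (X q) :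
      TotalSpace (HGModel n) (TangentSpace (𝓡 (4 * n)) : M → Type _))) p

theorem SmoothEndo.mdifferentiableAt_apply {A : Π p : M, HGTangent n p →L[ℝ] HGTangent n p}
    (hA : SmoothEndo A) {Y : Π p : M, HGTangent n p} {p : M}
    (hY : DiffFieldAt Y p) : DiffFieldAt (fun q ↦ A q (Y q)) p := by
  have h1 := (hA.contMDiffAt (x := p)).mdifferentiableAt (by simp)
  exact MDifferentiableAt.clm_bundle_apply (b := fun q : M ↦ q) h1 hY

theorem tensorialAt_covDerivEndo (D : HGConnection n M)
    {A : Π p : M, HGTangent n p →L[ℝ] HGTangent n p} (hA : SmoothEndo A) (p : M) :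
    TensorialAt (𝓡 (4 * n)) (HGModel n)
      (fun Y : Π p : M, HGTangent n p ↦ D (fun q ↦ A q (Y q)) p - (A p).comp (D Y p)) p where
  smul {f σ} hf hσ := by
    have h1 : (fun q ↦ A q ((f • σ) q)) = f • (fun q ↦ A q (σ q)) := by
      ext1 q; simp
    rw [h1, D.isCovariantDerivativeOn.leibniz (hA.mdifferentiableAt_apply hσ) hf,
      D.isCovariantDerivativeOn.leibniz hσ hf]
    ext v
    simp
    module
  add {σ σ'} hσ hσ' := by
    have h1 : (fun q ↦ A q ((σ + σ') q)) = (fun q ↦ A q (σ q)) + (fun q ↦ A q (σ' q)) := by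
      ext1 q; simp
    rw [h1, D.isCovariantDerivativeOn.add (hA.mdifferentiableAt_apply hσ)
      (hA.mdifferentiableAt_apply hσ'), D.isCovariantDerivativeOn.add hσ hσ']
    ext v
    simp
    abel

/-- The covariant derivative of a smooth field `A` of endomorphisms, as a tensor: for tangent
vectors `x`, `y` at `p`, the vector `(D_x A) y` is `covDerivEndo D hA p y x`. -/
def covDerivEndo (D : HGConnection n M)
    {A : Π p : M, HGTangent n p →L[ℝ] HGTangent n p} (hA : SmoothEndo A) (p : M) :
    HGTangent n p →L[ℝ] HGTangent n p →L[ℝ] HGTangent n p :=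
  TensorialAt.mkHom _ p (tensorialAt_covDerivEndo D hA p)

/-- `(D_x A) Y = D_x (A Y) - A (D_x Y)`. -/
theorem covDerivEndo_apply (D : HGConnection n M)
    {A : Π p : M, HGTangent n p →L[ℝ] HGTangent n p} (hA : SmoothEndo A) {p : M}
    {Y : Π p : M, HGTangent n p} (hY : DiffFieldAt Y p) (x : HGTangent n p) :
    covDerivEndo D hA p (Y p) x = D (fun q ↦ A q (Y q)) p x - A p (D Y p x) := by
  rw [covDerivEndo, TensorialAt.mkHom_apply _ hY]
  rfl

/-- The curvature `D_X D_Y Z - D_Y D_X Z - D_[X,Y] Z` of a connection. -/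
def curvatureField (D : HGConnection n M) (X Y Z : Π p : M, HGTangent n p) (p : M) :
    HGTangent n p :=
  D (fun q ↦ D Z q (Y q)) p (X p) - D (fun q ↦ D Z q (X q)) p (Y p)
    - D Z p (VectorField.mlieBracket (𝓡 (4 * n)) X Y p)

/-- `D` is the Levi-Civita connection of the metric `g`: the smooth torsion-free connection
with respect to which `g` is parallel. -/
structure IsLeviCivita (g : Π p : M, HGTangent n p →L[ℝ] HGTangent n p →L[ℝ] ℝ)
    (D : HGConnection n M) : Prop where
  smooth : CovariantDerivative.ContMDiffCovariantDerivative D ∞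
  torsion_free : ∀ {X Y : Π p : M, HGTangent n p} {p : M},
    DiffFieldAt X p → DiffFieldAt Y p →
      D Y p (X p) - D X p (Y p) = VectorField.mlieBracket (𝓡 (4 * n)) X Y p
  metric : ∀ {Y Z : Π p : M, HGTangent n p} {p : M},
    DiffFieldAt Y p → DiffFieldAt Z p → ∀ v : HGTangent n p,
      mvfderiv (𝓡 (4 * n)) (fun q ↦ g q (Y q) (Z q)) p v = g p (D Y p v) (Z p) + g p (Y p) (D Z p v)

end Connections

/-! ### Almost hypercomplex manifolds with Hermitian and anti-Hermitian metrics -/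

/-- An almost hypercomplex structure `(J₁, J₂, J₃)` on a `4n`-dimensional manifold together with
a pseudo-Riemannian metric `g` that is Hermitian for `J₁` and anti-Hermitian for `J₂`, `J₃`. -/
structure AlmostHGStructure (n : ℕ) (M : Type*) [TopologicalSpace M]
    [ChartedSpace (HGModel n) M] [IsManifold (𝓡 (4 * n)) ∞ M] where
  /-- The almost complex structures `J₁, J₂, J₃`. -/
  J : Fin 3 → Π p : M, HGTangent n p →L[ℝ] HGTangent n p
  /-- The metric. -/
  g : Π p : M, HGTangent n p →L[ℝ] HGTangent n p →L[ℝ] ℝ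
  smooth_J : ∀ α, SmoothEndo (J α)
  smooth_g : SmoothBilin g
  J_sq : ∀ α p v, J α p (J α p v) = -v
  J_eq_comp : ∀ α p v, J α p v = J (α + 1) p (J (α + 2) p v)
  J_eq_neg_comp : ∀ α p v, J α p v = -J (α + 2) p (J (α + 1) p v)
  g_symm : ∀ p v w, g p v w = g p w v
  g_nondeg : ∀ p v, (∀ w, g p v w = 0) → v = 0
  g_compat : ∀ α p v w, g p v w = hgSign α * g p (J α p v) (J α p w)

namespace AlmostHGStructure

variable {n : ℕ} {M : Type*} [TopologicalSpace M] [ChartedSpace (HGModel n) M]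
  [IsManifold (𝓡 (4 * n)) ∞ M] (S : AlmostHGStructure n M)

/-- The metric at a point as a bilinear form. -/
def gForm (p : M) : LinearMap.BilinForm ℝ (HGTangent n p) :=
  LinearMap.mk₂ ℝ (fun v w ↦ S.g p v w) (by simp) (by simp) (by simp) (by simp)

theorem gForm_nondegenerate (p : M) : (S.gForm p).Nondegenerate :=
  ⟨fun v hv ↦ S.g_nondeg p v hv, fun v hv ↦ S.g_nondeg p v fun w ↦ by
    rw [S.g_symm]; exact hv w⟩

/-- The associated bilinear forms `g_α(x, y) = g(J_α x, y)`. -/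
def gAssoc (α : Fin 3) (p : M) (x y : HGTangent n p) : ℝ := S.g p (S.J α p x) y

instance finiteDimensional_tangent (p : M) : FiniteDimensional ℝ (HGTangent n p) :=
  inferInstanceAs (FiniteDimensional ℝ (HGModel n))

/-- The vector that corresponds to a covector by means of the metric. -/
def sharp (p : M) (φ : Module.Dual ℝ (HGTangent n p)) : HGTangent n p :=
  ((S.gForm p).toDual (S.gForm_nondegenerate p)).symm φ

theorem g_sharp (p : M) (φ : Module.Dual ℝ (HGTangent n p)) (y : HGTangent n p) :
    S.g p (S.sharp p φ) y = φ y :=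
  LinearMap.BilinForm.apply_toDual_symm_apply (B := S.gForm p) (hB := S.gForm_nondegenerate p) φ y

/-- The structural tensors `F_α(x, y, z) = g((∇_x J_α) y, z)`. -/
def F (D : HGConnection n M) (α : Fin 3) (p : M) (x y z : HGTangent n p) : ℝ :=
  S.g p (covDerivEndo D (S.smooth_J α) p y x) z

/-- For fixed `z`, the bilinear form `(x, y) ↦ F_α(x, y, z)`. -/
def FForm (D : HGConnection n M) (α : Fin 3) (p : M) (z : HGTangent n p) :
    LinearMap.BilinForm ℝ (HGTangent n p) :=
  LinearMap.mk₂ ℝ (fun x y ↦ S.F D α p x y z) (by simp [F]) (by simp [F]) (by simp [F])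
    (by simp [F])

/-- The Lee forms `θ_α(z) = gⁱʲ F_α(eᵢ, eⱼ, z)`. -/
def lee (D : HGConnection n M) (α : Fin 3) (p : M) : Module.Dual ℝ (HGTangent n p) where
  toFun z := metricContraction (S.gForm p) (S.gForm_nondegenerate p) (S.FForm D α p z)
  map_add' z w := by
    rw [← metricContraction_add]
    congr 1
    ext x y
    simp [FForm, F]
  map_smul' r z := by
    rw [RingHom.id_apply, smul_eq_mul, ← metricContraction_smul]
    congr 1
    ext x y
    simp [FForm, F]

/-- The manifold belongs to the class `𝒲 = 𝒲(J₁) ∩ 𝒲(J₂) ∩ 𝒲(J₃)`; here `D` is to be the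
Levi-Civita connection. -/
structure IsW (D : HGConnection n M) : Prop where
  class_one : ∀ p (x y z : HGTangent n p),
    S.F D 0 p x y z = 1 / (2 * (2 * (n : ℝ) - 1)) *
      (S.g p x y * S.lee D 0 p z - S.g p x z * S.lee D 0 p y
        - S.g p x (S.J 0 p y) * S.lee D 0 p (S.J 0 p z)
        + S.g p x (S.J 0 p z) * S.lee D 0 p (S.J 0 p y))
  class_two_three : ∀ α, α = 1 ∨ α = 2 → ∀ p (x y z : HGTangent n p),
    S.F D α p x y z = 1 / (4 * (n : ℝ)) *
      (S.g p x y * S.lee D α p z + S.g p x z * S.lee D α p y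
        + S.g p x (S.J α p y) * S.lee D α p (S.J α p z)
        + S.g p x (S.J α p z) * S.lee D α p (S.J α p y))

/-- The one-form `4n / (1 - ε_α (4n - 1)) θ_α ∘ J_α`. On a `𝒲`-manifold it is the same for
`α = 1, 2, 3`. -/
def theta (D : HGConnection n M) (α : Fin 3) (p : M) : Module.Dual ℝ (HGTangent n p) :=
  (4 * (n : ℝ) / (1 - hgSign α * (4 * (n : ℝ) - 1))) •
    (S.lee D α p ∘ₗ (S.J α p : HGTangent n p →ₗ[ℝ] HGTangent n p))

/-- The tensor `Q(y, z) = ¼ ∑_α (∇_y J_α) J_α z`, which is `Q p z y` here. -/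
def Q (D : HGConnection n M) (p : M) :
    HGTangent n p →L[ℝ] HGTangent n p →L[ℝ] HGTangent n p :=
  (1 / 4 : ℝ) • ∑ α : Fin 3, (covDerivEndo D (S.smooth_J α) p).comp (S.J α p)

/-- The connection `∇_y z + Q(y, z)`, where `∇` is to be the Levi-Civita connection. -/
def connection (D : HGConnection n M) : HGConnection n M := D.addOneForm (S.Q D)

/-- The covariant curvature tensor `(X, Y, Z, W) ↦ g(R(X, Y) Z, W)` of a connection. -/
def curvature (D : HGConnection n M) (X Y Z W : Π p : M, HGTangent n p) (p : M) : ℝ :=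
  S.g p (curvatureField D X Y Z p) (W p)

/-- The Kulkarni-Nomizu product `g ⊙ h`. -/
def kulkarniNomizu (p : M) (h : HGTangent n p → HGTangent n p → ℝ)
    (x y z w : HGTangent n p) : ℝ :=
  S.g p x z * h y w - S.g p y z * h x w + S.g p y w * h x z - S.g p x w * h y z

/-- The tensor `B` of a one-form `θ`, with `Ω` the vector of `θ`. -/
def tensorB (p : M) (θ : Module.Dual ℝ (HGTangent n p)) (x y : HGTangent n p) : ℝ :=
  3 * (θ x * θ y) + ∑ α : Fin 3, θ (S.J α p x) * θ (S.J α p y)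
    - 3 / 2 * θ (S.sharp p θ) * S.g p x y
    - 1 / 2 * θ (S.J 1 p (S.sharp p θ)) * S.gAssoc 1 p x y
    - 1 / 2 * θ (S.J 2 p (S.sharp p θ)) * S.gAssoc 2 p x y

/-- The tensor `E` of a one-form `θ`. -/
def tensorE (p : M) (θ : Module.Dual ℝ (HGTangent n p)) (z w : HGTangent n p) : ℝ :=
  θ z * θ (S.J 0 p w) - θ (S.J 0 p z) * θ w
    - θ (S.J 1 p z) * θ (S.J 2 p w) + θ (S.J 2 p z) * θ (S.J 1 p w)

/-- The tensor `U(x, y, z, w) = g₁(x, y) E(z, w)` of a one-form `θ`. -/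
def tensorU (p : M) (θ : Module.Dual ℝ (HGTangent n p)) (x y z w : HGTangent n p) : ℝ :=
  S.gAssoc 0 p x y * S.tensorE p θ z w

/-- The tensor `Ŝ = R + 1/(64n²) g ⊙ B + 1/(128n²) U`; `D` is to be the Levi-Civita connection
and `θ` the Lee form. -/
def hatS (D : HGConnection n M) (θ : Π p : M, Module.Dual ℝ (HGTangent n p))
    (X Y Z W : Π p : M, HGTangent n p) (p : M) : ℝ :=
  S.curvature D X Y Z W p
    + 1 / (64 * (n : ℝ) ^ 2) *
      S.kulkarniNomizu p (S.tensorB p (θ p)) (X p) (Y p) (Z p) (W p)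
    + 1 / (128 * (n : ℝ) ^ 2) * S.tensorU p (θ p) (X p) (Y p) (Z p) (W p)

/-- `(L ∘ J_α)(x, y, z, w) = L(x, y, J_α z, J_α w)`. -/
def compJ (L : (X Y Z W : Π p : M, HGTangent n p) → M → ℝ) (α : Fin 3)
    (X Y Z W : Π p : M, HGTangent n p) (p : M) : ℝ :=
  L X Y (fun q ↦ S.J α q (Z q)) (fun q ↦ S.J α q (W q)) p

end AlmostHGStructure

end

noncomputable section

namespace AlmostHGStructure

variable {n : ℕ} {M : Type*} [TopologicalSpace M] [ChartedSpace (HGModel n) M]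
  [IsManifold (𝓡 (4 * n)) ∞ M] (S : AlmostHGStructure n M)

/-! ### Quaternionic relations and the metric -/

/-! Since `J_α² = -1`, the connection `D = ∇ + Q` is the quaternionic average `D_x Z = ¼ (∇_x Z - ∑
J_α ∇_x (J_α Z))` (`connection_apply_eq_average`). Differentiating this average once more produces
no derivative of `∇J_α`: the curvature of `D` is the same average of `R`, plus commutator terms
quadratic in `∇J_α` and in `Q` (`curvatureField_connection`). Moving `J_α` across `g` turns the
average into `R + R ∘ J₁ - R ∘ J₂ - R ∘ J₃`, up to the factor `¼`.

On a `𝒲`-manifold the three forms `θ` coincide (`theta_eq_theta`): differentiate `J_α = J_{α+1}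
J_{α+2}` and take traces. Each `∇J_α` is then one algebraic expression in `g`, `J_α` and the vector
`Ω` of `θ` (`covDerivEndo_eq_leeEndo`). What remains is a pointwise identity, quadratic in `Ω`,
between the commutator terms and the `J`-average of `g ⊙ B + ½ U` (`g_quadratic`). -/

theorem J_one_J_two (p : M) (v : HGTangent n p) : S.J 1 p (S.J 2 p v) = S.J 0 p v :=
  (S.J_eq_comp 0 p v).symm

theorem J_two_J_zero (p : M) (v : HGTangent n p) : S.J 2 p (S.J 0 p v) = S.J 1 p v :=
  (S.J_eq_comp 1 p v).symm

theorem J_zero_J_one (p : M) (v : HGTangent n p) : S.J 0 p (S.J 1 p v) = S.J 2 p v :=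
  (S.J_eq_comp 2 p v).symm

theorem J_two_J_one (p : M) (v : HGTangent n p) : S.J 2 p (S.J 1 p v) = -S.J 0 p v := by
  rw [S.J_eq_neg_comp 0, neg_neg]; rfl

theorem J_zero_J_two (p : M) (v : HGTangent n p) : S.J 0 p (S.J 2 p v) = -S.J 1 p v := by
  rw [S.J_eq_neg_comp 1, neg_neg]; rfl

theorem J_one_J_zero (p : M) (v : HGTangent n p) : S.J 1 p (S.J 0 p v) = -S.J 2 p v := by
  rw [S.J_eq_neg_comp 2, neg_neg]; rfl

theorem g_J_left (α : Fin 3) (p : M) (v w : HGTangent n p) :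
    S.g p (S.J α p v) w = -hgSign α * S.g p v (S.J α p w) := by
  have h := S.g_compat α p (S.J α p v) w
  rw [S.J_sq, map_neg] at h
  rw [h]; simp

theorem g_J_zero_left (p : M) (v w : HGTangent n p) :
    S.g p (S.J 0 p v) w = -S.g p v (S.J 0 p w) := by
  simp [S.g_J_left, hgSign]

theorem g_J_one_left (p : M) (v w : HGTangent n p) :
    S.g p (S.J 1 p v) w = S.g p v (S.J 1 p w) := by
  simp [S.g_J_left, hgSign]

theorem g_J_two_left (p : M) (v w : HGTangent n p) :
    S.g p (S.J 2 p v) w = S.g p v (S.J 2 p w) := by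
  simp [S.g_J_left, hgSign]

theorem g_J_zero_swap (p : M) (v w : HGTangent n p) :
    S.g p v (S.J 0 p w) = -S.g p w (S.J 0 p v) := by
  rw [S.g_symm, S.g_J_zero_left]

theorem g_J_one_swap (p : M) (v w : HGTangent n p) :
    S.g p v (S.J 1 p w) = S.g p w (S.J 1 p v) := by
  rw [S.g_symm, S.g_J_one_left]

theorem g_J_two_swap (p : M) (v w : HGTangent n p) :
    S.g p v (S.J 2 p w) = S.g p w (S.J 2 p v) := by
  rw [S.g_symm, S.g_J_two_left]

theorem g_J_zero_self (p : M) (v : HGTangent n p) : S.g p v (S.J 0 p v) = 0 := by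
  linarith [S.g_J_zero_swap p v v]

/-! ### The quadratic part of the curvature -/

/-- The endomorphism `y ↦ (∇_x J_α) y` of a `𝒲`-manifold in terms of the vector `v` of the Lee
form, up to the factor `1 / (4n)`. -/
def leeEndo (α : Fin 3) (p : M) (v x y : HGTangent n p) : HGTangent n p :=
  -S.g p x y • S.J α p v - S.g p v (S.J α p y) • x + S.g p x (S.J α p y) • v
    + S.g p v y • S.J α p x

/-- The endomorphism `y ↦ Q(x, y)` of a `𝒲`-manifold in terms of the vector `v` of the Lee form,
up to the factor `1 / (16n)`. -/
def leeQ (p : M) (v x y : HGTangent n p) : HGTangent n p :=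
  ∑ α : Fin 3, S.leeEndo α p v x (S.J α p y)

/-- The algebraic part of `Ŝ`, up to the factor `1 / (64n²)`. -/
def leeHatS (p : M) (θ : Module.Dual ℝ (HGTangent n p)) (x y z w : HGTangent n p) : ℝ :=
  S.kulkarniNomizu p (S.tensorB p θ) x y z w + 1 / 2 * S.tensorU p θ x y z w

/-- Pure quaternionic algebra: with `θ = g(Ω, ·)`, both sides are polynomials in the numbers `g(a,
J_α b)`. Once every `J` is moved to the right and the pairs among `Ω, x, y` are put in a fixed
order, the two polynomials agree. The weight 4 offsets the factor `¼` contained in each `Q`. -/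
theorem g_quadratic (p : M) (θ : Module.Dual ℝ (HGTangent n p)) (x y z w : HGTangent n p) :
    4 * S.g p (∑ α : Fin 3,
        (S.leeEndo α p (S.sharp p θ) y (S.leeEndo α p (S.sharp p θ) x z)
          - S.leeEndo α p (S.sharp p θ) x (S.leeEndo α p (S.sharp p θ) y z))) w
      + S.g p (S.leeQ p (S.sharp p θ) x (S.leeQ p (S.sharp p θ) y z)
          - S.leeQ p (S.sharp p θ) y (S.leeQ p (S.sharp p θ) x z)) w =
    S.leeHatS p θ x y z w + S.leeHatS p θ x y (S.J 0 p z) (S.J 0 p w)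
      - S.leeHatS p θ x y (S.J 1 p z) (S.J 1 p w)
      - S.leeHatS p θ x y (S.J 2 p z) (S.J 2 p w) := by
  have hθ : ∀ v, θ v = S.g p (S.sharp p θ) v := fun v => (S.g_sharp p θ v).symm
  -- The equation `hv` is kept because unfolding `tensorB` exposes further occurrences of the vector
  -- of `θ`.
  generalize hv : S.sharp p θ = v at *
  simp only [
    leeQ, leeEndo, leeHatS, kulkarniNomizu, tensorB, tensorU, tensorE, gAssoc, hθ, hv,
    Fin.sum_univ_three, map_add, map_sub, map_neg, map_smul, add_apply, sub_apply, smul_apply,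
    smul_eq_mul, S.J_sq, S.J_one_J_two, S.J_two_J_zero, S.J_zero_J_one, S.J_two_J_one,
    S.J_zero_J_two, S.J_one_J_zero, S.g_J_zero_left, S.g_J_one_left, S.g_J_two_left, neg_neg,
    S.g_J_zero_self, S.g_symm p x v, S.g_symm p y v, S.g_symm p y x, S.g_J_zero_swap p x v,
    S.g_J_zero_swap p y v, S.g_J_zero_swap p y x, S.g_J_one_swap p x v, S.g_J_one_swap p y v,
    S.g_J_one_swap p y x, S.g_J_two_swap p x v, S.g_J_two_swap p y v, S.g_J_two_swap p y x]
  ring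

end AlmostHGStructure

/-! ### Covariant derivatives of endomorphisms -/

section CovariantDerivatives

variable {n : ℕ} {M : Type*} [TopologicalSpace M] [ChartedSpace (HGModel n) M]
  [IsManifold (𝓡 (4 * n)) ∞ M]

theorem SmoothField.diffFieldAt {X : Π p : M, HGTangent n p} (hX : SmoothField X) (p : M) :
    DiffFieldAt X p :=
  (hX.contMDiffAt (x := p)).mdifferentiableAt (by simp)

theorem SmoothEndo.smoothField_apply {A : Π p : M, HGTangent n p →L[ℝ] HGTangent n p}
    (hA : SmoothEndo A) {Y : Π p : M, HGTangent n p} (hY : SmoothField Y) :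
    SmoothField (fun q ↦ A q (Y q)) :=
  ContMDiff.clm_bundle_apply (b := fun q : M ↦ q) hA hY

theorem smoothField_covDeriv {D : HGConnection n M}
    (hD : CovariantDerivative.ContMDiffCovariantDerivative D ∞)
    {Y Z : Π p : M, HGTangent n p} (hY : SmoothField Y) (hZ : SmoothField Z) :
    SmoothField (fun q ↦ D Z q (Y q)) := by
  have h := contMDiffOn_univ.1 (hD.contMDiff.contMDiff (σ := Z) (contMDiffOn_univ.2 hZ))
  exact ContMDiff.clm_bundle_apply (b := fun q : M ↦ q) h hY

/-- Every tangent vector is the value of a vector field that is differentiable at its base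
point. -/
theorem exists_diffFieldAt {p : M} (v : HGTangent n p) :
    ∃ Y : Π p : M, HGTangent n p, DiffFieldAt Y p ∧ Y p = v :=
  ⟨FiberBundle.extend (HGModel n) v, FiberBundle.mdifferentiableAt_extend .., by simp⟩

theorem covDeriv_endo_apply (D : HGConnection n M)
    {A : Π p : M, HGTangent n p →L[ℝ] HGTangent n p} (hA : SmoothEndo A) {p : M}
    {Y : Π p : M, HGTangent n p} (hY : DiffFieldAt Y p) (x : HGTangent n p) :
    D (fun q ↦ A q (Y q)) p x = covDerivEndo D hA p (Y p) x + A p (D Y p x) := by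
  rw [covDerivEndo_apply D hA hY, sub_add_cancel]

theorem covDeriv_neg (D : HGConnection n M) {p : M} {Y : Π p : M, HGTangent n p}
    (hY : DiffFieldAt Y p) : D (fun q ↦ -Y q) p = -D Y p := by
  have h := D.isCovariantDerivativeOn.smul_const (s := Set.univ) (-1 : ℝ) hY
  rw [neg_one_smul, neg_one_smul] at h
  exact h

/-- A covariant derivative commutes with linear combinations of the shape
`¼ (Y - ∑ Y_α)`. -/
theorem covDeriv_average (D : HGConnection n M) {p : M} {Y : Π p : M, HGTangent n p}
    {V : Fin 3 → Π p : M, HGTangent n p} (hY : DiffFieldAt Y p) (hV : ∀ α, DiffFieldAt (V α) p) :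
    D (fun q ↦ (1 / 4 : ℝ) • (Y q - ∑ α : Fin 3, V α q)) p =
      (1 / 4 : ℝ) • (D Y p - ∑ α : Fin 3, D (V α) p) := by
  have hs : DiffFieldAt (V 0 + V 1 + V 2) p :=
    mdifferentiableAt_add_section (mdifferentiableAt_add_section (hV 0) (hV 1)) (hV 2)
  have hn : DiffFieldAt ((-1 : ℝ) • (V 0 + V 1 + V 2)) p :=
    MDifferentiableAt.smul_const_section hs
  have h : (fun q ↦ (1 / 4 : ℝ) • (Y q - ∑ α : Fin 3, V α q)) =
      (1 / 4 : ℝ) • (Y + (-1 : ℝ) • (V 0 + V 1 + V 2)) := by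
    ext1 q
    simp only [Fin.sum_univ_three, Pi.smul_apply, Pi.add_apply]
    module
  rw [h, D.isCovariantDerivativeOn.smul_const (s := Set.univ) _
      (mdifferentiableAt_add_section hY hn),
    D.isCovariantDerivativeOn.add (s := Set.univ) hY hn,
    D.isCovariantDerivativeOn.smul_const (s := Set.univ) _ hs,
    D.isCovariantDerivativeOn.add (s := Set.univ)
      (mdifferentiableAt_add_section (hV 0) (hV 1)) (hV 2),
    D.isCovariantDerivativeOn.add (s := Set.univ) (hV 0) (hV 1), Fin.sum_univ_three]
  module

/-- The product rule `D_x (A B) = (D_x A) B + A (D_x B)`. -/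
theorem covDerivEndo_of_comp (D : HGConnection n M)
    {A B C : Π p : M, HGTangent n p →L[ℝ] HGTangent n p} (hA : SmoothEndo A) (hB : SmoothEndo B)
    (hC : SmoothEndo C) (h : ∀ p v, C p v = A p (B p v)) (p : M) (y x : HGTangent n p) :
    covDerivEndo D hC p y x = covDerivEndo D hA p (B p y) x + A p (covDerivEndo D hB p y x) := by
  obtain ⟨Y, hY, rfl⟩ := exists_diffFieldAt y
  rw [covDerivEndo_apply D hC hY, covDerivEndo_apply D hB hY,
    covDerivEndo_apply D hA (Y := fun q ↦ B q (Y q)) (hB.mdifferentiableAt_apply hY)]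
  simp only [h, map_sub]
  abel

end CovariantDerivatives

/-! ### The averaged connection and its curvature -/

namespace AlmostHGStructure

variable {n : ℕ} {M : Type*} [TopologicalSpace M] [ChartedSpace (HGModel n) M]
  [IsManifold (𝓡 (4 * n)) ∞ M] (S : AlmostHGStructure n M)

theorem Q_apply (D : HGConnection n M) (p : M) (y x : HGTangent n p) :
    S.Q D p y x = (1 / 4 : ℝ) • ∑ α : Fin 3, covDerivEndo D (S.smooth_J α) p (S.J α p y) x := by
  simp [Q]

theorem connection_apply (D : HGConnection n M) (Y : Π p : M, HGTangent n p) (p : M)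
    (x : HGTangent n p) : S.connection D Y p x = D Y p x + S.Q D p (Y p) x :=
  rfl

/-- `D_x Z = ¼ (∇_x Z - ∑_α J_α ∇_x (J_α Z))`. -/
theorem connection_apply_eq_average (D : HGConnection n M) {Z : Π p : M, HGTangent n p} {p : M}
    (hZ : DiffFieldAt Z p) (x : HGTangent n p) :
    S.connection D Z p x =
      (1 / 4 : ℝ) • (D Z p x - ∑ α : Fin 3, S.J α p (D (fun q ↦ S.J α q (Z q)) p x)) := by
  -- Differentiate `J_α (J_α Z) = -Z`. The three terms `-∇_x Z`, with weight `¼`, reduce `∇_x Z` to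
  -- `¼ ∇_x Z`.
  have h : ∀ α, covDerivEndo D (S.smooth_J α) p (S.J α p (Z p)) x =
      -D Z p x - S.J α p (D (fun q ↦ S.J α q (Z q)) p x) := fun α ↦ by
    rw [covDerivEndo_apply D (S.smooth_J α) (Y := fun q ↦ S.J α q (Z q))
      ((S.smooth_J α).mdifferentiableAt_apply hZ)]
    simp only [S.J_sq, covDeriv_neg D hZ, neg_apply]
  rw [connection_apply, Q_apply]
  simp only [h, Fin.sum_univ_three]
  module

/-- The second covariant derivative `D_x D_Y Z`. -/
theorem connection_connection_apply {D : HGConnection n M}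
    (hD : CovariantDerivative.ContMDiffCovariantDerivative D ∞)
    {Y Z : Π p : M, HGTangent n p} (hY : SmoothField Y) (hZ : SmoothField Z) (p : M)
    (x : HGTangent n p) :
    S.connection D (fun q ↦ S.connection D Z q (Y q)) p x =
      (1 / 4 : ℝ) • (D (fun q ↦ D Z q (Y q)) p x
        - ∑ α : Fin 3, S.J α p (D (fun q ↦ D (fun r ↦ S.J α r (Z r)) q (Y q)) p x))
      - (1 / 4 : ℝ) • ∑ α : Fin 3, covDerivEndo D (S.smooth_J α) p
          (covDerivEndo D (S.smooth_J α) p (Z p) (Y p)) x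
      + S.Q D p (S.Q D p (Z p) (Y p)) x := by
  have hZ' := fun α ↦ (S.smooth_J α).smoothField_apply hZ
  have hV := fun α ↦ smoothField_covDeriv hD hY (hZ' α)
  have hJV := fun α ↦ (S.smooth_J α).smoothField_apply (hV α)
  have h : (fun q ↦ S.connection D Z q (Y q)) = fun q ↦ (1 / 4 : ℝ) • (D Z q (Y q)
      - ∑ α : Fin 3, S.J α q (D (fun r ↦ S.J α r (Z r)) q (Y q))) :=
    funext fun q ↦ S.connection_apply_eq_average D (hZ.diffFieldAt q) (Y q)
  have hJ : ∀ α, D (fun q ↦ S.J α q (D (fun r ↦ S.J α r (Z r)) q (Y q))) p x =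
      covDerivEndo D (S.smooth_J α) p (covDerivEndo D (S.smooth_J α) p (Z p) (Y p)) x
        + covDerivEndo D (S.smooth_J α) p (S.J α p (D Z p (Y p))) x
        + S.J α p (D (fun q ↦ D (fun r ↦ S.J α r (Z r)) q (Y q)) p x) := fun α ↦ by
    rw [covDeriv_endo_apply D (S.smooth_J α) ((hV α).diffFieldAt p),
      covDeriv_endo_apply D (S.smooth_J α) (hZ.diffFieldAt p), map_add, add_apply]
  -- The inner derivative is written as the average where it is differentiated, but as `∇_Y Z + Q(Y,
  -- Z)` where `Q` acts on it. The terms `(∇_x J_α) J_α ∇_Y Z` from the two places then cancel.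
  rw [connection_apply, connection_apply, map_add, add_apply, S.Q_apply D p (D Z p (Y p)), h,
    covDeriv_average D ((smoothField_covDeriv hD hY hZ).diffFieldAt p)
      fun α ↦ (hJV α).diffFieldAt p]
  simp only [smul_apply, sub_apply, sum_apply, hJ, Finset.sum_add_distrib]
  module

/-- Antisymmetrize the second derivative in `X, Y`. The term `D_[X,Y] Z`, also written as an
average, completes the second derivatives of `Z` and of the `J_α Z` to curvatures. -/
theorem curvatureField_connection {D : HGConnection n M}
    (hD : CovariantDerivative.ContMDiffCovariantDerivative D ∞)
    {X Y Z : Π p : M, HGTangent n p} (hX : SmoothField X) (hY : SmoothField Y)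
    (hZ : SmoothField Z) (p : M) :
    curvatureField (S.connection D) X Y Z p =
      (1 / 4 : ℝ) • (curvatureField D X Y Z p
        - ∑ α : Fin 3, S.J α p (curvatureField D X Y (fun q ↦ S.J α q (Z q)) p))
      + (1 / 4 : ℝ) • ∑ α : Fin 3,
          (covDerivEndo D (S.smooth_J α) p
            (covDerivEndo D (S.smooth_J α) p (Z p) (X p)) (Y p)
          - covDerivEndo D (S.smooth_J α) p
            (covDerivEndo D (S.smooth_J α) p (Z p) (Y p)) (X p))
      + (S.Q D p (S.Q D p (Z p) (Y p)) (X p) - S.Q D p (S.Q D p (Z p) (X p)) (Y p)) := by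
  rw [curvatureField, S.connection_connection_apply hD hY hZ,
    S.connection_connection_apply hD hX hZ,
    S.connection_apply_eq_average D (hZ.diffFieldAt p)]
  simp only [curvatureField, map_sub, Finset.sum_sub_distrib]
  module

end AlmostHGStructure

/-! ### Lee forms -/

theorem metricContraction_eq_trace {V : Type*} [AddCommGroup V] [Module ℝ V]
    [FiniteDimensional ℝ V] (g : LinearMap.BilinForm ℝ V) (hg : g.Nondegenerate)
    (b : LinearMap.BilinForm ℝ V) (T : V →ₗ[ℝ] V) (h : ∀ x y, g (T x) y = b x y) :
    metricContraction g hg b = LinearMap.trace ℝ V T := by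
  rw [metricContraction]
  congr 1
  ext x
  rw [LinearMap.comp_apply, LinearEquiv.coe_coe, LinearEquiv.symm_apply_eq]
  ext y
  rw [LinearMap.BilinForm.toDual_def, h]

namespace AlmostHGStructure

variable {n : ℕ} {M : Type*} [TopologicalSpace M] [ChartedSpace (HGModel n) M]
  [IsManifold (𝓡 (4 * n)) ∞ M] (S : AlmostHGStructure n M)

theorem g_ext {p : M} {v v' : HGTangent n p} (h : ∀ w, S.g p v w = S.g p v' w) : v = v' :=
  sub_eq_zero.1 (S.g_nondeg p _ fun w ↦ by rw [map_sub, sub_apply, h, sub_self])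

theorem g_J_right (α : Fin 3) (p : M) (v w : HGTangent n p) :
    S.g p v (S.J α p w) = -hgSign α * S.g p (S.J α p v) w := by
  fin_cases α <;> simp [S.g_J_left, hgSign]

/-- `J_α` equals both `J_{α+1} J_{α+2}` and `-J_{α+2} J_{α+1}`, and these two products have equal
traces up to the sign. -/
theorem trace_J (α : Fin 3) (p : M) :
    LinearMap.trace ℝ _ (S.J α p : HGTangent n p →ₗ[ℝ] HGTangent n p) = 0 := by
  let A : HGTangent n p →ₗ[ℝ] HGTangent n p := (S.J (α + 1) p).toLinearMap
  let B : HGTangent n p →ₗ[ℝ] HGTangent n p := (S.J (α + 2) p).toLinearMap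
  have h₁ : (S.J α p : HGTangent n p →ₗ[ℝ] HGTangent n p) = A * B :=
    LinearMap.ext fun v ↦ S.J_eq_comp α p v
  have h₂ : (S.J α p : HGTangent n p →ₗ[ℝ] HGTangent n p) = -(B * A) :=
    LinearMap.ext fun v ↦ S.J_eq_neg_comp α p v
  have h : LinearMap.trace ℝ _ (A * B) = -LinearMap.trace ℝ _ (B * A) := by
    rw [← map_neg, ← h₁, ← h₂]
  rw [LinearMap.trace_mul_comm ℝ B A] at h
  rw [h₁]
  linarith

/-- The product rule for `J_α = J_{α+1} J_{α+2}`; the sign condition makes `J_{α+1}` self-adjoint,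
so it passes to `z` unchanged. -/
theorem F_eq_F_add_F (D : HGConnection n M) (α : Fin 3) (p : M) (x y z : HGTangent n p)
    (hα : hgSign (α + 1) = -1) :
    S.F D α p x y z =
      S.F D (α + 1) p x (S.J (α + 2) p y) z + S.F D (α + 2) p x y (S.J (α + 1) p z) := by
  rw [F, covDerivEndo_of_comp D (S.smooth_J (α + 1)) (S.smooth_J (α + 2)) (S.smooth_J α)
    (S.J_eq_comp α), map_add, add_apply, S.g_J_left, hα]
  simp [F]

theorem lee_apply_eq_trace (D : HGConnection n M) (α : Fin 3) (p : M) (z : HGTangent n p)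
    (T : HGTangent n p →ₗ[ℝ] HGTangent n p) (h : ∀ x y, S.g p (T x) y = S.F D α p x y z) :
    S.lee D α p z = LinearMap.trace ℝ _ T :=
  metricContraction_eq_trace _ _ _ T h

/-- The endomorphism `x ↦ (F_α(x, ·, z))^♯`. -/
theorem exists_g_eq_F (D : HGConnection n M) (α : Fin 3) (p : M) (z : HGTangent n p) :
    ∃ T : HGTangent n p →ₗ[ℝ] HGTangent n p, ∀ x y, S.g p (T x) y = S.F D α p x y z :=
  ⟨((S.gForm p).toDual (S.gForm_nondegenerate p)).symm.toLinearMap ∘ₗ S.FForm D α p z,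
    fun x y ↦ S.g_sharp p (S.FForm D α p z x) y⟩

theorem J_add_one_conj (α : Fin 3) (p : M) (v : HGTangent n p) :
    S.J α p (S.J (α + 1) p v) = S.J (α + 2) p v := by
  fin_cases α
  exacts [S.J_zero_J_one p v, S.J_one_J_two p v, S.J_two_J_zero p v]

/-- Contraction of the product rule. Its second term is a Lee form at once; the first, with `J_{α+2}
y` in the middle slot, is contracted through the explicit class formula for `α + 1`. -/
theorem lee_eq_lee_add_lee {D : HGConnection n M} (hW : S.IsW D) (α : Fin 3)
    (hα : α + 1 = 1 ∨ α + 1 = 2) (p : M) (z : HGTangent n p) :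
    S.lee D α p z = 1 / (2 * (n : ℝ)) * S.lee D (α + 1) p (S.J (α + 2) p z)
      + S.lee D (α + 2) p (S.J (α + 1) p z) := by
  have hs : hgSign (α + 1) = -1 := by rcases hα with h | h <;> simp [h, hgSign]
  obtain ⟨T, hT⟩ := S.exists_g_eq_F D (α + 2) p (S.J (α + 1) p z)
  set φ := S.lee D (α + 1) p
  set Jl : Fin 3 → HGTangent n p →ₗ[ℝ] HGTangent n p := fun β ↦ S.J β p
  -- Represents `F_{α+1}(x, J_{α+2} y, z)` as `g(T' x, y)`. The multiples of `J` are traceless, and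
  -- each rank-one term has trace `φ (J_{α+2} z)`; together they give the coefficient `1 / (2n)`.
  let T' : HGTangent n p →ₗ[ℝ] HGTangent n p := (1 / (4 * (n : ℝ))) •
    ((-hgSign (α + 2) * φ z) • Jl (α + 2) + (-hgSign α * φ (S.J (α + 1) p z)) • Jl α
      + (S.gForm p z).smulRight (S.sharp p (φ ∘ₗ Jl (α + 2)))
      + (S.gForm p (S.J (α + 1) p z)).smulRight (S.sharp p (φ ∘ₗ Jl α)))
  have h : ∀ x y, S.g p ((T' + T) x) y = S.F D α p x y z := fun x y ↦ by
    rw [S.F_eq_F_add_F D α p x y z hs, LinearMap.add_apply, map_add, add_apply, hT,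
      hW.class_two_three _ hα, ← S.J_eq_comp, S.g_J_right (α + 2) p x y, S.g_J_right α p x y,
      S.g_symm p x z, S.g_symm p x (S.J (α + 1) p z)]
    simp [T', Jl, S.g_sharp, gForm, φ]
    ring
  have hJ : S.J α p (S.J (α + 1) p z) = S.J (α + 2) p z := S.J_add_one_conj α p z
  rw [S.lee_apply_eq_trace D α p z _ h, map_add, ← S.lee_apply_eq_trace D (α + 2) p _ T hT]
  simp only [T', Jl, map_add, map_smul, S.trace_J, LinearMap.trace_smulRight]
  simp [gForm, S.g_symm p _ (S.sharp p _), S.g_sharp, hJ]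
  ring

/-! ### The one-form `θ` and the tensors it determines -/

theorem theta_apply (D : HGConnection n M) (α : Fin 3) (p : M) (z : HGTangent n p) :
    S.theta D α p z =
      4 * (n : ℝ) / (1 - hgSign α * (4 * (n : ℝ) - 1)) * S.lee D α p (S.J α p z) :=
  rfl

theorem lee_zero_apply (hn : 1 ≤ n) (D : HGConnection n M) (p : M) (z : HGTangent n p) :
    S.lee D 0 p z = (2 * (n : ℝ) - 1) / (2 * n) * S.theta D 0 p (S.J 0 p z) := by
  have hn' : (1 : ℝ) ≤ n := by exact_mod_cast hn
  have h₁ : 2 * (n : ℝ) - 1 ≠ 0 := by linarith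
  rw [theta_apply, S.J_sq, map_neg, show hgSign 0 = 1 from rfl,
    show 1 - 1 * (4 * (n : ℝ) - 1) = -2 * (2 * n - 1) by ring]
  field_simp
  ring

theorem lee_one_apply (hn : 1 ≤ n) (D : HGConnection n M) (p : M) (z : HGTangent n p) :
    S.lee D 1 p z = -S.theta D 1 p (S.J 1 p z) := by
  have hn' : (n : ℝ) ≠ 0 := by positivity
  rw [theta_apply, S.J_sq, map_neg, show hgSign 1 = -1 from rfl]
  field_simp
  ring

theorem lee_two_apply (hn : 1 ≤ n) (D : HGConnection n M) (p : M) (z : HGTangent n p) :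
    S.lee D 2 p z = -S.theta D 2 p (S.J 2 p z) := by
  have hn' : (n : ℝ) ≠ 0 := by positivity
  rw [theta_apply, S.J_sq, map_neg, show hgSign 2 = -1 from rfl]
  field_simp
  ring

/-- On a `𝒲`-manifold the Lee form `θ` does not depend on the almost complex structure. -/
theorem theta_eq_theta (hn : 1 ≤ n) {D : HGConnection n M} (hW : S.IsW D) (α β : Fin 3) (p : M) :
    S.theta D α p = S.theta D β p := by
  have hn' : (1 : ℝ) ≤ n := by exact_mod_cast hn
  have h : ∀ z, S.theta D 0 p z = S.theta D 1 p z ∧ S.theta D 1 p z = S.theta D 2 p z := by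
    intro z
    -- At `J_α z` all the `J`s cancel. With `a, b, c` the values at `z` of the three forms, the two
    -- relations read `(2n - 1) a = 2n c - b` and `(2n - 1) a = 2n b - c`; hence `(2n + 1) b = (2n +
    -- 1) c`.
    have h₀ := S.lee_eq_lee_add_lee hW 0 (Or.inl rfl) p (S.J 0 p z)
    have h₁ := S.lee_eq_lee_add_lee hW 1 (Or.inr rfl) p (S.J 1 p z)
    simp only [show (0 : Fin 3) + 1 = 1 from rfl, show (0 : Fin 3) + 2 = 2 from rfl,
      show (1 : Fin 3) + 1 = 2 from rfl, show (1 : Fin 3) + 2 = 0 from rfl,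
      S.lee_zero_apply hn, S.lee_one_apply hn, S.lee_two_apply hn, S.J_sq,
      S.J_two_J_zero, S.J_zero_J_one, S.J_two_J_one, S.J_one_J_zero, map_neg, neg_neg] at h₀ h₁
    field_simp at h₀ h₁
    generalize S.theta D 0 p z = a at *
    generalize S.theta D 1 p z = b at *
    generalize S.theta D 2 p z = c at *
    have hbc : b = c := by
      apply mul_left_cancel₀ (show (2 * (n : ℝ) + 1) ≠ 0 by linarith)
      linarith
    refine ⟨?_, hbc⟩
    subst hbc
    apply mul_left_cancel₀ (show (2 * (n : ℝ) - 1) ≠ 0 by linarith)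
    linarith
  have h' : ∀ γ, S.theta D γ p = S.theta D 0 p := fun γ ↦ by
    ext z
    fin_cases γ
    exacts [rfl, (h z).1.symm, ((h z).1.trans (h z).2).symm]
  rw [h', h' β]

/-- The normalization of `θ` absorbs both the different constants and the different signs in the
class conditions, so that one formula serves all three `J_α`. -/
theorem covDerivEndo_eq_leeEndo (hn : 1 ≤ n) {D : HGConnection n M} (hW : S.IsW D) (κ α : Fin 3)
    (p : M) (x y : HGTangent n p) :
    covDerivEndo D (S.smooth_J α) p y x =
      (1 / (4 * (n : ℝ))) • S.leeEndo α p (S.sharp p (S.theta D κ p)) x y := by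
  have hn' : (1 : ℝ) ≤ n := by exact_mod_cast hn
  have h₂ : 2 * (n : ℝ) - 1 ≠ 0 := by linarith
  refine S.g_ext fun z ↦ ?_
  change S.F D α p x y z = _
  rw [S.theta_eq_theta hn hW κ α]
  have hθ : ∀ v, S.g p (S.sharp p (S.theta D α p)) v = S.theta D α p v := S.g_sharp p _
  fin_cases α
  · simp only [Fin.zero_eta, Fin.isValue] at *
    rw [hW.class_one]
    simp only [leeEndo, map_add, map_sub, map_smul, add_apply, sub_apply, smul_apply, smul_eq_mul,
      S.g_J_zero_left, hθ, S.lee_zero_apply hn, S.J_sq, map_neg]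
    field_simp
    ring
  · simp only [Fin.mk_one, Fin.isValue] at *
    rw [hW.class_two_three 1 (Or.inl rfl)]
    simp only [leeEndo, map_add, map_sub, map_smul, add_apply, sub_apply, smul_apply, smul_eq_mul,
      S.g_J_one_left, hθ, S.lee_one_apply hn, S.J_sq, map_neg]
    ring
  · simp only [Fin.reduceFinMk, Fin.isValue] at *
    rw [hW.class_two_three 2 (Or.inr rfl)]
    simp only [leeEndo, map_add, map_sub, map_smul, add_apply, sub_apply, smul_apply, smul_eq_mul,
      S.g_J_two_left, hθ, S.lee_two_apply hn, S.J_sq, map_neg]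
    ring

theorem Q_eq_leeQ (hn : 1 ≤ n) {D : HGConnection n M} (hW : S.IsW D) (κ : Fin 3)
    (p : M) (x y : HGTangent n p) :
    S.Q D p y x = (1 / (16 * (n : ℝ))) • S.leeQ p (S.sharp p (S.theta D κ p)) x y := by
  simp only [Q_apply, S.covDerivEndo_eq_leeEndo hn hW κ, leeQ, ← Finset.smul_sum, smul_smul]
  congr 1
  ring

theorem leeEndo_smul (α : Fin 3) (p : M) (v x y : HGTangent n p) (r : ℝ) :
    S.leeEndo α p v x (r • y) = r • S.leeEndo α p v x y := by
  simp only [leeEndo, map_smul, smul_eq_mul]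
  module

theorem leeQ_smul (p : M) (v x y : HGTangent n p) (r : ℝ) :
    S.leeQ p v x (r • y) = r • S.leeQ p v x y := by
  simp only [leeQ, map_smul, leeEndo_smul, Finset.smul_sum]

theorem hatS_eq (D : HGConnection n M) (θ : Π p : M, Module.Dual ℝ (HGTangent n p))
    (X Y Z W : Π p : M, HGTangent n p) (p : M) :
    S.hatS D θ X Y Z W p = S.curvature D X Y Z W p
      + 1 / (64 * (n : ℝ) ^ 2) * S.leeHatS p (θ p) (X p) (Y p) (Z p) (W p) := by
  rw [hatS, leeHatS]
  ring

end AlmostHGStructure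

end

theorem proposition10 {n : ℕ} (hn : 1 ≤ n) {M : Type*} [TopologicalSpace M]
    [ChartedSpace (HGModel n) M] [IsManifold (𝓡 (4 * n)) ∞ M]
    (S : AlmostHGStructure n M)
    (LC : HGConnection n M) (hLC : IsLeviCivita S.g LC)
    (hW : S.IsW LC) (κ : Fin 3)
    (X Y Z W : Π p : M, HGTangent n p)
    (hX : SmoothField X) (hY : SmoothField Y) (hZ : SmoothField Z) (hWf : SmoothField W) (p : M) :
    S.curvature (S.connection LC) X Y Z W p =
      1 / 4 * (S.hatS LC (S.theta LC κ) X Y Z W p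
        + S.compJ (S.hatS LC (S.theta LC κ)) 0 X Y Z W p
        - S.compJ (S.hatS LC (S.theta LC κ)) 1 X Y Z W p
        - S.compJ (S.hatS LC (S.theta LC κ)) 2 X Y Z W p) := by
  have hq := S.g_quadratic p (S.theta LC κ p) (X p) (Y p) (Z p) (W p)
  rw [AlmostHGStructure.curvature, S.curvatureField_connection hLC.smooth hX hY hZ]
  simp only [S.covDerivEndo_eq_leeEndo hn hW κ, S.Q_eq_leeQ hn hW κ, S.leeEndo_smul, S.leeQ_smul,
    AlmostHGStructure.compJ, S.hatS_eq, AlmostHGStructure.curvature]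
  -- Moving `J_α` from `J_α R(X, Y) J_α Z` onto `W` produces the signs `+, -, -` of the statement.
  simp only [Fin.sum_univ_three, map_add, map_sub, map_smul, add_apply, sub_apply, smul_apply,
    smul_eq_mul, S.g_J_zero_left, S.g_J_one_left, S.g_J_two_left] at hq ⊢
  -- The factor is `¼ · 1/(64n²)` on the side of `Ŝ`, and `(1/(16n))²` on the side of `Q`.
  linear_combination (1 / (256 * (n : ℝ) ^ 2)) * hq
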